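/- Let $C\subset\mathbb R^p$ be a convex set with the origin in its interior, let $\|x\|_C=\inf\{t>0: x\in tC\}$ be its gauge and $\partial\|x\|_C$ the subdifferential of the gauge at $x$. Let $n\ge 1$, $X^\star[1],\dots,X^\star[n]\in\mathbb R^p$, and $Y[t]=X^\star[t]+\varepsilon[t]$ for $1\le t\le n$, where the $\varepsilon[t]\sim\mathcal N(0,\sigma^2 I_{p\times p})$ are independent and $\sigma>0$. Put $\tau^\star=\{1\le t\le n-1: X^\star[t]\ne X^\star[t+1]\}$, with elements $t_1^\star<t_2^\star<\cdots$, $\Delta_{\min}=\min_{t\in\tau^\star}\|X^\star[t]-X^\star[t+1]\|_2$ and $T_{\min}=\min_{s\ne t\in\tau^\star}|s-t|$ (if a minimum is over an empty set, that is, if $\tau^\star=\emptyset$, respectively $|\tau^\star|\le 1$, the number $\Delta_{\min}$, respectively $T_{\min}$, may be any real number that satisfies the conditions below). For $\tilde\lambda\ge 0$ let $$F(\tilde\lambda)=\max_{1\le t\le n}\ \mathbb E_{g\sim\mathcal N(0,I_{p\times p})}\big[\mathrm{dist}(g,\tilde\lambda\cdot\partial\|X^\star[t]\|_C)\big],\qquad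 \eta=\inf_{\tilde\lambda\ge 0}F(\tilde\lambda).$$ Let $r>1$ and suppose that $$\Delta_{\min}^2T_{\min}\ge 64\sigma^2\big\{\eta+r\sqrt{2\log n}\big\}^2,\qquad T_{\min}/4\le t\le n-T_{\min}/4\ \text{ for all } t\in\tau^\star.$$ Let $\theta\ge1$ be an integer and $\gamma,\lambda$ be real numbers with $\theta\le T_{\min}/4$, $\ \Delta_{\min}/2\ge\gamma\ge 2\frac{\sigma}{\sqrt\theta}\{\eta+r\sqrt{2\log n}\}$, and $\lambda=\frac{\sigma}{\sqrt\theta}\lambda_0$ for some minimizer $\lambda_0$ of $F$ over $[0,\infty)$. Consider the following algorithm. Compute $\bar Y[i]=\frac1\theta\sum_{t=i}^{i+\theta-1}Y[t]$ and $\hat X[i]=\operatorname{argmin}_{x}\frac12\|\bar Y[i]-x\|_2^2+\lambda\|x\|_C$ for $1\le i\le n-\theta+1$, and $S[t]=\|\hat X[t+1]-\hat X[t-\theta+1]\|_2$ for $\theta\le t\le n-\theta$; set $S[t]$ to $0$ whenever $S[t]<\gamma$; list the $t$ with $S[t]\neq0$ in increasing order and cut this list into maximal runs, called groups, in which consecutive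 members are at most $\theta$ apart. Return the groups $g_1,g_2,\dots$ in increasing order. Then with probability greater than $1-4n^{1-r^2}$ the following hold together: (i) there are exactly $|\tau^\star|$ groups; (ii) for each $j$, the $j$-th group satisfies $g_j\subset\{\theta,\dots,n-\theta\}$ and $|t_j^\star-\tilde t|\le\theta$ for all $\tilde t\in g_j$. -/

import Mathlib

open MeasureTheory ProbabilityTheory
open scoped Pointwise

namespace ChangePoint

/-- `ℝ^p` with the Euclidean (`ℓ₂`) norm. -/
abbrev E (p : ℕ) := EuclideanSpace ℝ (Fin p)

/-- The subdifferential of `f : ℝ^p → ℝ` at `x`. -/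
def subdifferential {p : ℕ} (f : E p → ℝ) (x : E p) : Set (E p) :=
  {z | ∀ y, f x + inner ℝ z (y - x) ≤ f y}

/-- `E[dist(g, l • ∂‖x‖_C)]` for a standard Gaussian vector `g` in `ℝ^p`, where `‖·‖_C` is the
Minkowski functional (gauge) of `C`. -/
noncomputable def expectedDist {p : ℕ} (C : Set (E p)) (x : E p) (l : ℝ) : ℝ :=
  ∫ g, Metric.infDist g (l • subdifferential (gauge C) x) ∂(stdGaussian (E p))

/-- `max_{1 ≤ t ≤ n} E[dist(g, l • ∂‖X[t]‖_C)]`. -/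
noncomputable def maxExpectedDist {p : ℕ} (C : Set (E p)) (n : ℕ) (X : ℕ → E p) (l : ℝ) : ℝ :=
  ⨆ t : Finset.Icc 1 n, expectedDist C (X t) l

/-- The Gaussian distance `η_C(𝒳)` of the collection `𝒳 = {X[1], …, X[n]}`. -/
noncomputable def gaussianDistance {p : ℕ} (C : Set (E p)) (n : ℕ) (X : ℕ → E p) : ℝ :=
  ⨅ l : Set.Ici (0 : ℝ), maxExpectedDist C n X l

open scoped Classical in
/-- The set of change-points of `X[1], …, X[n]`: the times `1 ≤ t ≤ n - 1` with
`X[t] ≠ X[t+1]`. -/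
noncomputable def changePoints {p : ℕ} (n : ℕ) (X : ℕ → E p) : Finset ℕ :=
  (Finset.Ico 1 n).filter fun t => X t ≠ X (t + 1)

/-- `Δ` is the size of the smallest change; no constraint if there is no change-point. -/
def IsMinChange {p : ℕ} (n : ℕ) (X : ℕ → E p) (Δ : ℝ) : Prop :=
  (changePoints n X).Nonempty →
    IsLeast {d : ℝ | ∃ t ∈ changePoints n X, d = ‖X t - X (t + 1)‖} Δ

/-- `T` is the smallest distance between two distinct change-points; no constraint if there are
fewer than two change-points. -/
def IsMinSpacing {p : ℕ} (n : ℕ) (X : ℕ → E p) (T : ℝ) : Prop :=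
  (changePoints n X : Set ℕ).Nontrivial →
    IsLeast {d : ℝ | ∃ s ∈ changePoints n X, ∃ t ∈ changePoints n X,
      s ≠ t ∧ d = |(s : ℝ) - (t : ℝ)|} T

/-- Filtering: the sample mean `(1/θ) ∑_{t=i}^{i+θ-1} Y[t]`. -/
noncomputable def sampleMean {p : ℕ} (θ : ℕ) (Y : ℕ → E p) (i : ℕ) : E p :=
  (1 / (θ : ℝ)) • ∑ t ∈ Finset.Ico i (i + θ), Y t

/-- Denoising: the minimizer of `x ↦ ½‖y - x‖² + lam ‖x‖_C`. For `lam ≥ 0` and `C` convex with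
the origin in its interior the minimizer exists and is unique. -/
noncomputable def prox {p : ℕ} (C : Set (E p)) (lam : ℝ) (y : E p) : E p :=
  Classical.epsilon fun x =>
    IsMinOn (fun z => (1 / 2) * ‖y - z‖ ^ 2 + lam * gauge C z) Set.univ x

/-- The denoised averages `X̂[t]`. -/
noncomputable def denoised {p : ℕ} (C : Set (E p)) (θ : ℕ) (lam : ℝ) (Y : ℕ → E p) (t : ℕ) :
    E p :=
  prox C lam (sampleMean θ Y t)

/-- Differencing: `S[t] = ‖X̂[t+1] - X̂[t-θ+1]‖`, used for `θ ≤ t ≤ n - θ`. -/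
noncomputable def derivativeNorm {p : ℕ} (C : Set (E p)) (θ : ℕ) (lam : ℝ) (Y : ℕ → E p)
    (t : ℕ) : ℝ :=
  ‖denoised C θ lam Y (t + 1) - denoised C θ lam Y (t - θ + 1)‖

open scoped Classical in
/-- Thresholding: `S[t]` is set to `0` if `S[t] < γ`. -/
noncomputable def thresholded {p : ℕ} (C : Set (E p)) (θ : ℕ) (γ lam : ℝ) (Y : ℕ → E p)
    (t : ℕ) : ℝ :=
  if derivativeNorm C θ lam Y t < γ then 0 else derivativeNorm C θ lam Y t

open scoped Classical in
/-- The time indices `θ ≤ t ≤ n - θ` at which the thresholded derivative is non-zero. -/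
noncomputable def activeTimes {p : ℕ} (C : Set (E p)) (n θ : ℕ) (γ lam : ℝ) (Y : ℕ → E p) :
    Finset ℕ :=
  (Finset.Icc θ (n - θ)).filter fun t => thresholded C θ γ lam Y t ≠ 0

/-- Output of the modified algorithm: the increasing list of active times is cut into maximal
runs in which consecutive members are at most `θ` apart; the groups are listed in increasing
order. -/
noncomputable def groups {p : ℕ} (C : Set (E p)) (n θ : ℕ) (γ lam : ℝ) (Y : ℕ → E p) :
    List (List ℕ) :=
  ((activeTimes C n θ γ lam Y).sort (· ≤ ·)).splitBy fun s t => decide (t - s ≤ θ)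

end ChangePoint

/-! At a point `x` observed with error `z`, proximal denoising errs by at most the distance from `z`
to `lam • subdifferential (gauge C) x` (`norm_prox_sub_le_infDist`). Over a window of `θ` equal
signal values, `z` is `σ/√θ` times a standard Gaussian vector. Since `lam = σ/√θ * lam₀`, this
factor comes out of the distance. What remains is a 1-Lipschitz function of a standard Gaussian,
whose mean is at most `η` because `lam₀` minimizes `F`. Concentration at deviation `r√(2 log n)`
costs `n^(-r²)` per window, hence at most `n^(1-r²)` over all windows.

Outside that event every window of constancy is denoised within `κ = (σ/√θ)(η + r√(2 log n)) ≤ γ/2`,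
and the rest is deterministic (`groups_spec`). At a change-point both adjacent windows are constant
and `S > Δ - 2κ ≥ γ`. At distance `θ` or more from all change-points `S < 2κ ≤ γ`. So the active
times form one cluster around each change-point, and the `4θ` spacing keeps the clusters apart
(`splitBy_sort_eq_map_cluster`).

The exponent `r²` needs the sharp tail `exp(-s²/2)` of `stdGaussian_concentration`, which is derived
from the Prékopa–Leindler inequality. -/

namespace ChangePoint

/-! ### Brunn–Minkowski and Prékopa–Leindler on the line. -/

section PrekopaLeindler

open Set

/-- The one-dimensional Brunn–Minkowski inequality for compact sets. -/
lemma volume_convexCombo_le_of_isCompact {t : ℝ} (ht0 : 0 < t) (ht1 : t < 1) {K L D : Set ℝ}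
    (hK : IsCompact K) (hL : IsCompact L) (hKn : K.Nonempty) (hLn : L.Nonempty)
    (hD : ∀ a ∈ K, ∀ b ∈ L, (1 - t) * a + t * b ∈ D) :
    ENNReal.ofReal (1 - t) * volume K + ENNReal.ofReal t * volume L ≤ volume D := by
  obtain ⟨a, haK, ha⟩ := hK.exists_isGreatest hKn
  obtain ⟨b, hbL, hb⟩ := hL.exists_isLeast hLn
  have h1t : 0 < 1 - t := by linarith
  -- With `a = max K` and `b = min L`, these translates of `(1-t)K` and `tL` both lie in `D`, on
  -- opposite sides of `(1-t)a + tb`. They share at most that point, so their volumes add.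
  set K' : Set ℝ := (fun x => x + t * b) '' ((1 - t) • K) with hK'
  set L' : Set ℝ := (fun x => x + (1 - t) * a) '' (t • L) with hL'
  have vK : volume K' = ENNReal.ofReal (1 - t) * volume K := by
    rw [hK', image_add_right, measure_preimage_add_right, Measure.addHaar_smul]
    simp [abs_of_pos h1t]
  have vL : volume L' = ENNReal.ofReal t * volume L := by
    rw [hL', image_add_right, measure_preimage_add_right, Measure.addHaar_smul]
    simp [abs_of_pos ht0]
  have mL : MeasurableSet L' :=
    ((hL.smul t).image (by fun_prop)).measurableSet
  have hdisj : AEDisjoint volume K' L' := by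
    refine measure_mono_null (t := {(1 - t) * a + t * b}) ?_ (by simp)
    rintro _ ⟨⟨_, ⟨x, hx, rfl⟩, rfl⟩, ⟨_, ⟨y, hy, rfl⟩, hxy⟩⟩
    have h1 : (1 - t) * x ≤ (1 - t) * a := mul_le_mul_of_nonneg_left (ha hx) h1t.le
    have h2 : t * b ≤ t * y := mul_le_mul_of_nonneg_left (hb hy) ht0.le
    simp only [smul_eq_mul, mem_singleton_iff] at hxy ⊢
    linarith
  rw [← vK, ← vL, ← measure_union₀ mL.nullMeasurableSet hdisj]
  refine measure_mono ?_
  rintro _ (⟨_, ⟨x, hx, rfl⟩, rfl⟩ | ⟨_, ⟨y, hy, rfl⟩, rfl⟩)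
  · exact hD x hx b hbL
  · have := hD a haK y hy
    simpa [add_comm] using this

/-- The one-dimensional Brunn–Minkowski inequality. -/
lemma volume_convexCombo_le {t : ℝ} (ht0 : 0 < t) (ht1 : t < 1) {A B D : Set ℝ}
    (hA : MeasurableSet A) (hB : MeasurableSet B) (hAn : A.Nonempty) (hBn : B.Nonempty)
    (hD : ∀ a ∈ A, ∀ b ∈ B, (1 - t) * a + t * b ∈ D) :
    ENNReal.ofReal (1 - t) * volume A + ENNReal.ofReal t * volume B ≤ volume D := by
  obtain ⟨a₀, ha₀⟩ := hAn
  obtain ⟨b₀, hb₀⟩ := hBn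
  rw [hA.measure_eq_iSup_isCompact, hB.measure_eq_iSup_isCompact]
  simp_rw [ENNReal.mul_iSup]
  have key : ∀ K : Set ℝ, K ⊆ A → IsCompact K → ∀ L : Set ℝ, L ⊆ B → IsCompact L →
      ENNReal.ofReal (1 - t) * volume K + ENNReal.ofReal t * volume L ≤ volume D := by
    intro K hKA hK L hLB hL
    -- Adjoining a point keeps the compact sets nonempty: `K` or `L` may be empty in the supremum.
    have hK' : K ∪ {a₀} ⊆ A := union_subset hKA (by simpa using ha₀)
    have hL' : L ∪ {b₀} ⊆ B := union_subset hLB (by simpa using hb₀)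
    refine le_trans ?_ (volume_convexCombo_le_of_isCompact ht0 ht1 (hK.union isCompact_singleton)
      (hL.union isCompact_singleton) ⟨a₀, by simp⟩ ⟨b₀, by simp⟩
      fun a ha b hb => hD a (hK' ha) b (hL' hb))
    gcongr <;> exact subset_union_left
  simp_rw [iSup_and']
  refine ENNReal.biSup_add_biSup_le' ⟨∅, by simp⟩ ⟨∅, by simp⟩ ?_
  intro K hK L hL
  exact key K hK.1 hK.2 L hL.1 hL.2

/-- The Prékopa–Leindler inequality on the line for functions with supremum `1`, in its additive
form. -/
lemma lintegral_convexCombo_le {t : ℝ} (ht0 : 0 < t) (ht1 : t < 1) {f g h : ℝ → ℝ}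
    (hf : Measurable f) (hg : Measurable g) (hh : Measurable h)
    (hf0 : ∀ x, 0 ≤ f x) (hg0 : ∀ x, 0 ≤ g x) (hh0 : ∀ x, 0 ≤ h x)
    (hf1 : IsLUB (range f) 1) (hg1 : IsLUB (range g) 1)
    (hfgh : ∀ x y, f x ^ (1 - t) * g y ^ t ≤ h ((1 - t) * x + t * y)) :
    ENNReal.ofReal (1 - t) * (∫⁻ x, ENNReal.ofReal (f x)) +
      ENNReal.ofReal t * (∫⁻ x, ENNReal.ofReal (g x)) ≤ ∫⁻ x, ENNReal.ofReal (h x) := by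
  have h1t : 0 < 1 - t := by linarith
  have layer : ∀ f : ℝ → ℝ, Measurable f → (∀ x, 0 ≤ f x) →
      ∫⁻ x, ENNReal.ofReal (f x) = ∫⁻ s in Ioi (0 : ℝ), volume {x | s < f x} := fun f hf hf0 =>
    lintegral_eq_lintegral_meas_lt _ (.of_forall hf0) hf.aemeasurable
  have layer1 : ∀ f : ℝ → ℝ, Measurable f → (∀ x, 0 ≤ f x) → IsLUB (range f) 1 →
      ∫⁻ x, ENNReal.ofReal (f x) = ∫⁻ s in Ioo (0 : ℝ) 1, volume {x | s < f x} := by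
    intro f hf hf0 hf1
    rw [layer f hf hf0, ← Ioo_union_Ici_eq_Ioi zero_lt_one,
      lintegral_union measurableSet_Ici (by
        rw [Set.disjoint_left]; intro x hx hx'; exact absurd hx.2 (not_lt.2 hx'))]
    convert add_zero _
    rw [setLIntegral_congr_fun (g := fun _ => 0) measurableSet_Ici, lintegral_zero]
    intro s hs
    have : {x | s < f x} = ∅ := by
      ext x
      simpa using (hf1.1 ⟨x, rfl⟩).trans hs
    simp [this]
  have mono : ∀ f : ℝ → ℝ, Measurable fun s => volume {x | s < f x} := fun f =>
    Antitone.measurable fun s s' hs => measure_mono fun x hx => lt_of_le_of_lt hs hx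
  rw [layer1 f hf hf0 hf1, layer1 g hg hg0 hg1, layer h hh hh0,
    ← lintegral_const_mul _ (mono f), ← lintegral_const_mul _ (mono g),
    ← lintegral_add_left ((mono f).const_mul _)]
  refine le_trans ?_ (lintegral_mono_set (show Ioo (0 : ℝ) 1 ⊆ Ioi 0 from Ioo_subset_Ioi_self))
  refine setLIntegral_mono (mono h) fun s hs => ?_
  -- Both suprema equal 1, so for `s < 1` both superlevel sets are nonempty, as Brunn–Minkowski
  -- requires.
  obtain ⟨_, ⟨x₀, rfl⟩, hx₀⟩ := (lt_isLUB_iff hf1).1 hs.2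
  obtain ⟨_, ⟨y₀, rfl⟩, hy₀⟩ := (lt_isLUB_iff hg1).1 hs.2
  refine volume_convexCombo_le ht0 ht1 (measurableSet_lt measurable_const hf)
    (measurableSet_lt measurable_const hg) ⟨x₀, hx₀⟩ ⟨y₀, hy₀⟩ fun a ha b hb => ?_
  refine lt_of_lt_of_le ?_ (hfgh a b)
  calc s = s ^ (1 - t) * s ^ t := by rw [← Real.rpow_add hs.1]; simp
    _ < f a ^ (1 - t) * g b ^ t := by
      have := hs.1
      have ha' : s < f a := ha
      have hb' : s < g b := hb
      gcongr

/-- The Prékopa–Leindler inequality on the line, for bounded functions. -/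
theorem prekopaLeindler_real {t : ℝ} (ht0 : 0 < t) (ht1 : t < 1) {f g h : ℝ → ℝ}
    (hf : Measurable f) (hg : Measurable g) (hh : Measurable h)
    (hf0 : ∀ x, 0 ≤ f x) (hg0 : ∀ x, 0 ≤ g x) (hh0 : ∀ x, 0 ≤ h x)
    (hfb : BddAbove (range f)) (hgb : BddAbove (range g))
    (hfi : Integrable f) (hgi : Integrable g) (hhi : Integrable h)
    (hfgh : ∀ x y, f x ^ (1 - t) * g y ^ t ≤ h ((1 - t) * x + t * y)) :
    (∫ x, f x) ^ (1 - t) * (∫ x, g x) ^ t ≤ ∫ x, h x := by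
  have h1t : 0 < 1 - t := by linarith
  have hpos : ∀ f : ℝ → ℝ, (∀ x, 0 ≤ f x) → BddAbove (range f) → (∫ x, f x) ≠ 0 →
      0 < ⨆ x, f x := by
    intro f hf0 hfb hne
    obtain ⟨x, hx⟩ : ∃ x, f x ≠ 0 := by
      by_contra! hall
      exact hne (by simp [hall])
    exact lt_of_lt_of_le (lt_of_le_of_ne (hf0 x) (Ne.symm hx)) (le_ciSup hfb x)
  have hh_int : 0 ≤ ∫ x, h x := integral_nonneg hh0
  by_cases hfz : ∫ x, f x = 0
  · rw [hfz, Real.zero_rpow h1t.ne', zero_mul]; exact hh_int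
  by_cases hgz : ∫ x, g x = 0
  · rw [hgz, Real.zero_rpow ht0.ne', mul_zero]; exact hh_int
  set A := ⨆ x, f x with hA
  set B := ⨆ x, g x with hB
  have hApos : 0 < A := hpos f hf0 hfb hfz
  have hBpos : 0 < B := hpos g hg0 hgb hgz
  -- Dividing `f`, `g`, `h` by `A`, `B`, `c` preserves the pointwise hypothesis and makes both
  -- suprema 1.
  set c := A ^ (1 - t) * B ^ t with hc
  have hcpos : 0 < c := by positivity
  have lub : ∀ f : ℝ → ℝ, BddAbove (range f) → 0 < (⨆ x, f x) →
      IsLUB (range fun x => f x / ⨆ x, f x) 1 := by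
    intro f hfb hp
    have h1 : IsLUB (range f) (⨆ x, f x) := isLUB_ciSup hfb
    constructor
    · rintro _ ⟨x, rfl⟩
      exact (div_le_one hp).2 (le_ciSup hfb x)
    · intro b hb
      have : (⨆ x, f x) ≤ b * ⨆ x, f x := ciSup_le fun x => (div_le_iff₀ hp).1 (hb ⟨x, rfl⟩)
      exact le_of_mul_le_mul_right (by simpa using this) hp
  have key := lintegral_convexCombo_le ht0 ht1 (hf.div_const A) (hg.div_const B)
    (hh.div_const c) (fun x => div_nonneg (hf0 x) hApos.le) (fun x => div_nonneg (hg0 x) hBpos.le)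
    (fun x => div_nonneg (hh0 x) hcpos.le) (lub f hfb hApos) (lub g hgb hBpos) (by
      intro x y
      rw [Real.div_rpow (hf0 x) hApos.le, Real.div_rpow (hg0 y) hBpos.le, div_mul_div_comm]
      exact div_le_div_of_nonneg_right (hfgh x y) hcpos.le)
  have hf_int : 0 ≤ ∫ x, f x := integral_nonneg hf0
  have hg_int : 0 ≤ ∫ x, g x := integral_nonneg hg0
  rw [← ofReal_integral_eq_lintegral_ofReal (hfi.div_const A)
      (.of_forall fun x => div_nonneg (hf0 x) hApos.le),
    ← ofReal_integral_eq_lintegral_ofReal (hgi.div_const B)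
      (.of_forall fun x => div_nonneg (hg0 x) hBpos.le),
    ← ofReal_integral_eq_lintegral_ofReal (hhi.div_const c)
      (.of_forall fun x => div_nonneg (hh0 x) hcpos.le),
    integral_div, integral_div, integral_div,
    ← ENNReal.ofReal_mul h1t.le, ← ENNReal.ofReal_mul ht0.le, ← ENNReal.ofReal_add
      (by positivity) (by positivity),
    ENNReal.ofReal_le_ofReal_iff (by positivity)] at key
  -- AM–GM turns the additive form into the multiplicative one; the normalizing constants then
  -- cancel.
  have amgm := Real.geom_mean_le_arith_mean2_weighted h1t.le ht0.le
    (div_nonneg hf_int hApos.le) (div_nonneg hg_int hBpos.le) (by ring)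
  have := amgm.trans key
  rw [Real.div_rpow hf_int hApos.le, Real.div_rpow hg_int hBpos.le, div_mul_div_comm] at this
  exact (div_le_div_iff_of_pos_right hcpos).1 this

end PrekopaLeindler

/-! ### Prékopa–Leindler for Gaussian product measures. -/

section GaussianPrekopaLeindler

lemma integrable_of_nonneg_of_le {α : Type*} [MeasurableSpace α] {μ : Measure α}
    [IsFiniteMeasure μ] {u : α → ℝ} (hu : Measurable u) (hu0 : ∀ x, 0 ≤ u x) {M : ℝ}
    (hM : ∀ x, u x ≤ M) : Integrable u μ :=
  Integrable.of_bound hu.aestronglyMeasurable M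
    (.of_forall fun x => by rw [Real.norm_of_nonneg (hu0 x)]; exact hM x)

/-- The two-function form of the Prékopa–Leindler inequality for the Gaussian measure on the
line. -/
lemma gaussianReal_prekopaLeindler {t : ℝ} (ht0 : 0 < t) (ht1 : t < 1) {u v : ℝ → ℝ} {k M N : ℝ}
    (hk : 0 ≤ k) (hu : Measurable u) (hv : Measurable v) (hu0 : ∀ x, 0 ≤ u x)
    (hv0 : ∀ x, 0 ≤ v x) (huM : ∀ x, u x ≤ M) (hvN : ∀ x, v x ≤ N)
    (huv : ∀ x y, u x ^ (1 - t) * v y ^ t ≤ k * Real.exp (t * (1 - t) / 2 * (x - y) ^ 2)) :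
    (∫ x, u x ∂gaussianReal 0 1) ^ (1 - t) * (∫ x, v x ∂gaussianReal 0 1) ^ t ≤ k := by
  have hφm : Measurable (gaussianPDFReal 0 1) := measurable_gaussianPDFReal 0 1
  have hφi : Integrable (gaussianPDFReal 0 1) := integrable_gaussianPDFReal 0 1
  have hφ0 : ∀ x, 0 < gaussianPDFReal 0 1 x := fun x => gaussianPDFReal_pos 0 1 x one_ne_zero
  have hφ1 : ∀ x, gaussianPDFReal 0 1 x ≤ (Real.sqrt (2 * Real.pi))⁻¹ := by
    intro x
    simp only [gaussianPDFReal, NNReal.coe_one, mul_one, sub_zero]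
    refine mul_le_of_le_one_right (by positivity) (Real.exp_le_one_iff.2 ?_)
    have := sq_nonneg x
    linarith
  have hint : ∀ (w : ℝ → ℝ) (M : ℝ), Measurable w → (∀ x, 0 ≤ w x) → (∀ x, w x ≤ M) →
      Integrable fun x => gaussianPDFReal 0 1 x * w x := by
    intro w M hw hw0 hwM
    refine (hφi.mul_const M).mono' (hφm.mul hw).aestronglyMeasurable (.of_forall fun x => ?_)
    rw [Real.norm_of_nonneg (mul_nonneg (hφ0 x).le (hw0 x))]
    exact mul_le_mul_of_nonneg_left (hwM x) (hφ0 x).le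
  have hbdd : ∀ (w : ℝ → ℝ) (M : ℝ), (∀ x, 0 ≤ w x) → (∀ x, w x ≤ M) →
      BddAbove (Set.range fun x => gaussianPDFReal 0 1 x * w x) := by
    rintro w M hw0 hwM
    refine ⟨(Real.sqrt (2 * Real.pi))⁻¹ * M, ?_⟩
    rintro _ ⟨x, rfl⟩
    exact mul_le_mul (hφ1 x) (hwM x) (hw0 x) (by positivity)
  have key := prekopaLeindler_real ht0 ht1 (hφm.mul hu) (hφm.mul hv) (hφm.mul_const k)
    (fun x => mul_nonneg (hφ0 x).le (hu0 x)) (fun x => mul_nonneg (hφ0 x).le (hv0 x))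
    (fun x => mul_nonneg (hφ0 x).le hk) (hbdd u M hu0 huM) (hbdd v N hv0 hvN)
    (hint u M hu hu0 huM) (hint v N hv hv0 hvN) (hφi.mul_const k) (by
      intro x y
      simp only [Pi.mul_apply]
      rw [Real.mul_rpow (hφ0 x).le (hu0 x), Real.mul_rpow (hφ0 y).le (hv0 y),
        mul_mul_mul_comm]
      refine (mul_le_mul_of_nonneg_left (huv x y) (by have := hφ0 x; have := hφ0 y; positivity)).trans
        (le_of_eq ?_)
      simp only [gaussianPDFReal, NNReal.coe_one, mul_one, sub_zero]
      set d := (Real.sqrt (2 * Real.pi))⁻¹ with hd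
      have hd0 : 0 < d := by positivity
      have hdd : d ^ (1 - t) * d ^ t = d := by rw [← Real.rpow_add hd0]; simp
      -- The identity `(1-t)x² + ty² - t(1-t)(x-y)² = ((1-t)x + ty)²`: the quadratic factor allowed
      -- on `u`, `v` is exactly the log-concavity defect of the density, so `h = k` times the
      -- density works.
      have hexp : Real.exp (-x ^ 2 / 2) ^ (1 - t) * Real.exp (-y ^ 2 / 2) ^ t *
          Real.exp (t * (1 - t) / 2 * (x - y) ^ 2) =
          Real.exp (-((1 - t) * x + t * y) ^ 2 / 2) := by
        rw [← Real.exp_mul, ← Real.exp_mul, ← Real.exp_add, ← Real.exp_add]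
        congr 1
        ring
      rw [Real.mul_rpow hd0.le (by positivity), Real.mul_rpow hd0.le (by positivity), ← hexp]
      nth_rewrite 3 [← hdd]
      ring)
  simp only [Pi.mul_apply] at key
  rw [integral_mul_const, integral_gaussianPDFReal_eq_one 0 one_ne_zero, one_mul] at key
  simpa only [integral_gaussianReal_eq_integral_smul (one_ne_zero), smul_eq_mul] using key

lemma integral_pi_gaussianReal_succ {n : ℕ} {u : (Fin (n + 1) → ℝ) → ℝ} (hu : Measurable u)
    (hu0 : ∀ x, 0 ≤ u x) {M : ℝ} (huM : ∀ x, u x ≤ M) :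
    ∫ x, u x ∂(Measure.pi fun _ : Fin (n + 1) => gaussianReal 0 1) =
      ∫ a, ∫ x, u (Fin.cons a x) ∂(Measure.pi fun _ : Fin n => gaussianReal 0 1)
        ∂gaussianReal 0 1 := by
  have h := (measurePreserving_piFinSuccAbove (fun _ : Fin (n + 1) => gaussianReal 0 1) 0).symm
  have hc := h.integral_comp' u
  rw [← hc, integral_prod]
  · simp [MeasurableEquiv.piFinSuccAbove, Fin.insertNthEquiv]
  · refine integrable_of_nonneg_of_le (M := M) (hu.comp ?_) (fun x => hu0 _) (fun x => huM _)
    exact MeasurableEquiv.measurable _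

lemma measurable_cons {n : ℕ} : Measurable fun p : ℝ × (Fin n → ℝ) =>
    (Fin.cons p.1 p.2 : Fin (n + 1) → ℝ) := by
  refine measurable_pi_iff.2 fun i => ?_
  refine Fin.cases ?_ (fun j => ?_) i
  · simpa using measurable_fst
  · exact (measurable_pi_apply j).comp measurable_snd

/-- The two-function form of the Prékopa–Leindler inequality for a product of Gaussian
measures. -/
lemma pi_gaussianReal_prekopaLeindler {t : ℝ} (ht0 : 0 < t) (ht1 : t < 1) {n : ℕ}
    {u v : (Fin n → ℝ) → ℝ} {k M N : ℝ}
    (hk : 0 ≤ k) (hu : Measurable u) (hv : Measurable v) (hu0 : ∀ x, 0 ≤ u x)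
    (hv0 : ∀ x, 0 ≤ v x) (huM : ∀ x, u x ≤ M) (hvN : ∀ x, v x ≤ N)
    (huv : ∀ x y, u x ^ (1 - t) * v y ^ t ≤
      k * Real.exp (t * (1 - t) / 2 * ∑ i, (x i - y i) ^ 2)) :
    (∫ x, u x ∂(Measure.pi fun _ : Fin n => gaussianReal 0 1)) ^ (1 - t) *
      (∫ x, v x ∂(Measure.pi fun _ : Fin n => gaussianReal 0 1)) ^ t ≤ k := by
  induction n generalizing k with
  | zero =>
    simp only [Measure.pi_of_empty _ (default : Fin 0 → ℝ), integral_dirac]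
    simpa using huv default default
  | succ n ih =>
    rw [integral_pi_gaussianReal_succ hu hu0 huM, integral_pi_gaussianReal_succ hv hv0 hvN]
    have hmeas : ∀ w : (Fin (n + 1) → ℝ) → ℝ, Measurable w → Measurable fun a =>
        ∫ x, w (Fin.cons a x) ∂(Measure.pi fun _ : Fin n => gaussianReal 0 1) := by
      intro w hw
      exact (StronglyMeasurable.integral_prod_right'
        (f := fun p : ℝ × (Fin n → ℝ) => w (Fin.cons p.1 p.2))
        (hw.comp measurable_cons).stronglyMeasurable).measurable
    have hbdd : ∀ (w : (Fin (n + 1) → ℝ) → ℝ) (M : ℝ), Measurable w → (∀ x, 0 ≤ w x) →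
        (∀ x, w x ≤ M) → ∀ a : ℝ,
        ∫ x, w (Fin.cons a x) ∂(Measure.pi fun _ : Fin n => gaussianReal 0 1) ≤ M := by
      intro w M hw hw0 hwM a
      have hm : Measurable fun x : Fin n → ℝ => w (Fin.cons a x) :=
        hw.comp (measurable_cons.comp (measurable_const.prodMk measurable_id))
      refine (integral_mono (integrable_of_nonneg_of_le hm (fun x => hw0 _) fun x => hwM _)
        (integrable_const M) fun x => hwM _).trans (by simp)
    refine gaussianReal_prekopaLeindler ht0 ht1 hk (hmeas u hu) (hmeas v hv)
      (fun a => integral_nonneg fun x => hu0 _) (fun a => integral_nonneg fun x => hv0 _)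
      (hbdd u M hu hu0 huM) (hbdd v N hv hv0 hvN) fun a b => ?_
    have hm : ∀ (w : (Fin (n + 1) → ℝ) → ℝ) (a : ℝ), Measurable w →
        Measurable fun x : Fin n → ℝ => w (Fin.cons a x) := fun w a hw =>
      hw.comp (measurable_cons.comp (measurable_const.prodMk measurable_id))
    -- The first coordinate's factor `exp(t(1-t)/2 (a-b)²)` is absorbed into `k`, which is why the
    -- induction generalizes over `k`.
    refine ih (by positivity) (hm u a hu) (hm v b hv) (fun x => hu0 _) (fun x => hv0 _)
      (fun x => huM _) (fun x => hvN _) fun x y => ?_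
    refine (huv _ _).trans (le_of_eq ?_)
    rw [mul_assoc, ← Real.exp_add, Fin.sum_univ_succ]
    simp [mul_add]

end GaussianPrekopaLeindler

/-! ### Sharp Gaussian concentration for Lipschitz functions. -/

section GaussianConcentration

lemma stdGaussian_prekopaLeindler {t : ℝ} (ht0 : 0 < t) (ht1 : t < 1) {p : ℕ}
    {u v : E p → ℝ} {M N : ℝ} (hu : Measurable u) (hv : Measurable v) (hu0 : ∀ x, 0 ≤ u x)
    (hv0 : ∀ x, 0 ≤ v x) (huM : ∀ x, u x ≤ M) (hvN : ∀ x, v x ≤ N)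
    (huv : ∀ x y, u x ^ (1 - t) * v y ^ t ≤ Real.exp (t * (1 - t) / 2 * ‖x - y‖ ^ 2)) :
    (∫ x, u x ∂(stdGaussian (E p))) ^ (1 - t) * (∫ x, v x ∂(stdGaussian (E p))) ^ t ≤ 1 := by
  have hm : Measurable (WithLp.toLp 2 : (Fin p → ℝ) → E p) := by fun_prop
  rw [← map_pi_eq_stdGaussian, integral_map hm.aemeasurable hu.aestronglyMeasurable,
    integral_map hm.aemeasurable hv.aestronglyMeasurable]
  refine pi_gaussianReal_prekopaLeindler ht0 ht1 zero_le_one (hu.comp hm) (hv.comp hm)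
    (fun x => hu0 _) (fun x => hv0 _) (fun x => huM _) (fun x => hvN _) fun x y => ?_
  refine (huv _ _).trans (le_of_eq ?_)
  rw [EuclideanSpace.norm_sq_eq]
  simp

/-- Gaussian concentration, with the sharp constant, for nonnegative `1`-Lipschitz functions. -/
theorem stdGaussian_concentration {p : ℕ} {f : E p → ℝ} (hf : LipschitzWith 1 f)
    (hf0 : ∀ x, 0 ≤ f x) {s : ℝ} (hs : 0 ≤ s) :
    (stdGaussian (E p)).real {x | (∫ y, f y ∂(stdGaussian (E p))) + s ≤ f x} ≤
      Real.exp (-s ^ 2 / 2) := by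
  set μ := stdGaussian (E p) with hμ
  set m := (∫ y, f y ∂μ) + s with hm
  set S := {x | m ≤ f x} with hS
  have hSm : MeasurableSet S := measurableSet_le measurable_const hf.continuous.measurable
  have hfi : Integrable f μ := by
    have hid : Integrable (fun x : E p => ‖x‖) μ := IsGaussian.integrable_id.norm
    refine ((integrable_const (f 0)).add hid).mono' hf.continuous.aestronglyMeasurable
      (.of_forall fun x => ?_)
    rw [Real.norm_of_nonneg (hf0 x)]
    have := hf.dist_le_mul x 0
    rw [Real.dist_eq, dist_zero_right] at this
    have := (abs_le.1 this).2
    simp only [NNReal.coe_one, one_mul, Pi.add_apply] at this ⊢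
    linarith
  have step : ∀ t : ℝ, 0 < t → t < 1 → μ.real S ≤ Real.exp (-(1 - t) * s ^ 2 / 2) := by
    intro t ht0 ht1
    have h1t : 0 < 1 - t := by linarith
    -- For `u = exp(-tsf)` and `v = c` on `S`, the exponent of `u(x)^(1-t) v(y)^t` is `t(1-t)(s(m -
    -- f x) - s²/2)`. Since `m - f x ≤ ‖x - y‖` for `y ∈ S`, completing the square bounds it by
    -- `t(1-t)‖x - y‖²/2`.
    set c := Real.exp ((1 - t) * (s * m - s ^ 2 / 2)) with hc
    have hu : Measurable fun x => Real.exp (-(t * s * f x)) :=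
      (hf.continuous.measurable.const_mul _).neg.exp
    have key := stdGaussian_prekopaLeindler (p := p) ht0 ht1 (u := fun x => Real.exp (-(t * s * f x)))
      (v := S.indicator fun _ => c) (M := 1) (N := c) hu
      (measurable_const.indicator hSm) (fun x => by positivity)
      (fun x => Set.indicator_nonneg (fun _ _ => by positivity) x)
      (fun x => Real.exp_le_one_iff.2 (neg_nonpos.2 (mul_nonneg (mul_nonneg ht0.le hs) (hf0 x))))
      (fun x => Set.indicator_le_self' (fun _ _ => by positivity) x)
      (by
        intro x y
        by_cases hy : y ∈ S
        · rw [Set.indicator_of_mem hy, ← Real.exp_mul, ← Real.exp_mul, ← Real.exp_add,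
            Real.exp_le_exp]
          have h1 : f y - f x ≤ ‖x - y‖ := by
            have := hf.dist_le_mul y x
            rw [Real.dist_eq, dist_comm, dist_eq_norm] at this
            simpa using (abs_le.1 this).2
          have h2 : m ≤ f y := hy
          have h3 : s * (m - f x) - s ^ 2 / 2 ≤ ‖x - y‖ ^ 2 / 2 := by
            have : s * (m - f x) ≤ s * ‖x - y‖ := mul_le_mul_of_nonneg_left (by linarith) hs
            nlinarith [sq_nonneg (s - ‖x - y‖)]
          have h4 : 0 ≤ t * (1 - t) := by positivity
          nlinarith [mul_le_mul_of_nonneg_left h3 h4]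
        · rw [Set.indicator_of_notMem hy, Real.zero_rpow ht0.ne', mul_zero]
          positivity)
    have hjensen : Real.exp (-(t * s * ∫ y, f y ∂μ)) ≤ ∫ x, Real.exp (-(t * s * f x)) ∂μ := by
      have hi := (hfi.const_mul (t * s)).neg
      have := convexOn_exp.map_integral_le (μ := μ) (f := fun x => -(t * s * f x))
        Real.continuous_exp.continuousOn isClosed_univ (.of_forall fun x => Set.mem_univ _) hi
        (integrable_of_nonneg_of_le hu (fun x => (Real.exp_pos _).le) (M := 1)
          (fun x => Real.exp_le_one_iff.2 (neg_nonpos.2 (mul_nonneg (mul_nonneg ht0.le hs) (hf0 x)))))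
      rwa [integral_neg, integral_const_mul] at this
    rw [integral_indicator hSm, setIntegral_const, smul_eq_mul] at key
    have hP : 0 ≤ μ.real S := measureReal_nonneg
    have key2 : Real.exp (-(t * s * ∫ y, f y ∂μ)) ^ (1 - t) * (μ.real S * c) ^ t ≤ 1 := by
      refine le_trans (mul_le_mul_of_nonneg_right ?_ ?_) key
      · exact Real.rpow_le_rpow (Real.exp_pos _).le hjensen h1t.le
      · exact Real.rpow_nonneg (mul_nonneg hP (Real.exp_pos _).le) _
    rw [← Real.exp_mul, Real.mul_rpow hP (Real.exp_pos _).le, ← Real.exp_mul, mul_left_comm,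
      ← Real.exp_add] at key2
    have key3 : μ.real S ^ t ≤ Real.exp (-(1 - t) * s ^ 2 / 2) ^ t := by
      rw [← Real.exp_mul, show -(1 - t) * s ^ 2 / 2 * t = -(t * (1 - t) * (s ^ 2 / 2)) by ring,
        Real.exp_neg, ← one_div, le_div_iff₀ (Real.exp_pos _)]
      refine le_of_eq_of_le ?_ key2
      congr 2
      rw [hm]; ring
    exact (Real.rpow_le_rpow_iff hP (by positivity) ht0).1 key3
  -- Letting `t → 0` removes the factor `1 - t` and yields the sharp constant.
  have hlim : Filter.Tendsto (fun t : ℝ => Real.exp (-(1 - t) * s ^ 2 / 2))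
      (nhdsWithin 0 (Set.Ioi 0)) (nhds (Real.exp (-s ^ 2 / 2))) := by
    have : Continuous fun t : ℝ => Real.exp (-(1 - t) * s ^ 2 / 2) := by fun_prop
    have h0 := this.tendsto 0
    simp only [sub_zero, neg_mul, one_mul] at h0 ⊢
    exact h0.mono_left nhdsWithin_le_nhds
  refine ge_of_tendsto hlim ?_
  filter_upwards [Ioo_mem_nhdsGT (zero_lt_one (α := ℝ))] with t ht
  exact step t ht.1 ht.2

end GaussianConcentration

/-! ### Subgradients of the gauge and the error of proximal denoising. -/

section Denoising

variable {p : ℕ} {C : Set (E p)}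

lemma absorbent_of_zero_mem_interior (hC0 : (0 : E p) ∈ interior C) : Absorbent ℝ C :=
  absorbent_nhds_zero (mem_interior_iff_mem_nhds.1 hC0)

/-- The gauge of a convex neighbourhood of the origin has a subgradient at every point. -/
lemma subdifferential_gauge_nonempty (hC : Convex ℝ C) (hC0 : (0 : E p) ∈ interior C) (x : E p) :
    (subdifferential (gauge C) x).Nonempty := by
  have habs := absorbent_of_zero_mem_interior hC0
  obtain ⟨φ, hφx, hφ⟩ : ∃ φ : E p →ₗ[ℝ] ℝ, φ x = gauge C x ∧ ∀ y, φ y ≤ gauge C y := by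
    by_cases hx : x = 0
    · exact ⟨0, by simp [hx], fun y => gauge_nonneg y⟩
    -- Hahn–Banach: on the line through `x`, the functional `c • x ↦ c * gauge C x` is dominated by
    -- the gauge. A dominated extension represents a subgradient at `x`.
    · let f : E p →ₗ.[ℝ] ℝ := LinearPMap.mkSpanSingleton x (gauge C x) hx
      obtain ⟨φ, h1, h2⟩ := exists_extension_of_le_sublinear f (gauge C)
        (fun c hc y => by rw [gauge_smul_of_nonneg hc.le, smul_eq_mul])
        (fun y z => gauge_add_le hC habs y z) (by
          rintro ⟨y, hy⟩
          obtain ⟨c, rfl⟩ := Submodule.mem_span_singleton.1 hy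
          rw [show f ⟨c • x, hy⟩ = c • gauge C x from LinearPMap.mkSpanSingleton'_apply _ _ _ _ _]
          rcases le_total 0 c with hc | hc
          · rw [gauge_smul_of_nonneg hc]
          · exact (smul_nonpos_of_nonpos_of_nonneg hc (gauge_nonneg x)).trans (gauge_nonneg _))
      refine ⟨φ, ?_, h2⟩
      have hm : x ∈ f.domain := Submodule.mem_span_singleton_self x
      rw [h1 ⟨x, hm⟩]
      exact LinearPMap.mkSpanSingleton_apply ℝ _ hx _
  refine ⟨(InnerProductSpace.toDual ℝ (E p)).symm (LinearMap.toContinuousLinearMap φ), fun y => ?_⟩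
  rw [InnerProductSpace.toDual_symm_apply]
  have : LinearMap.toContinuousLinearMap φ (y - x) = φ y - φ x := by simp
  rw [this, hφx]
  linarith [hφ y]

lemma continuous_gauge_of_zero_mem_interior (hC : Convex ℝ C) (hC0 : (0 : E p) ∈ interior C) :
    Continuous (gauge C) :=
  continuous_gauge hC (mem_interior_iff_mem_nhds.1 hC0)

/-- A continuous coercive function attains its minimum, so the `Classical.epsilon` in `prox` picks a
genuine minimizer. -/
lemma isMinOn_prox (hC : Convex ℝ C) (hC0 : (0 : E p) ∈ interior C) {lam : ℝ} (hlam : 0 ≤ lam)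
    (y : E p) :
    IsMinOn (fun z => (1 / 2) * ‖y - z‖ ^ 2 + lam * gauge C z) Set.univ (prox C lam y) := by
  refine Classical.epsilon_spec (p := fun x =>
    IsMinOn (fun z => (1 / 2) * ‖y - z‖ ^ 2 + lam * gauge C z) Set.univ x) ?_
  have hcont : Continuous fun z => (1 / 2) * ‖y - z‖ ^ 2 + lam * gauge C z := by
    have := continuous_gauge_of_zero_mem_interior hC hC0
    fun_prop
  have hlim : Filter.Tendsto (fun z => (1 / 2) * ‖y - z‖ ^ 2 + lam * gauge C z)
      (Filter.cocompact (E p)) Filter.atTop := by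
    have h1 : Filter.Tendsto (fun z : E p => ‖y - z‖) (Filter.cocompact (E p)) Filter.atTop := by
      simp_rw [← dist_eq_norm]
      exact tendsto_dist_left_cocompact_atTop y
    have h2 : Filter.Tendsto (fun z : E p => (1 / 2) * ‖y - z‖ ^ 2) (Filter.cocompact (E p))
        Filter.atTop :=
      ((Filter.tendsto_pow_atTop two_ne_zero).comp h1).const_mul_atTop (by norm_num)
    exact Filter.tendsto_atTop_mono
      (fun z => le_add_of_nonneg_right (mul_nonneg hlam (gauge_nonneg z))) h2
  obtain ⟨x, hx⟩ := hcont.exists_forall_le hlim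
  exact ⟨x, fun z _ => hx z⟩

/-- First-order optimality of the proximal point against an arbitrary competitor. -/
lemma mul_gauge_sub_le_inner (hC : Convex ℝ C) (hC0 : (0 : E p) ∈ interior C) {lam : ℝ}
    (hlam : 0 ≤ lam) (y x : E p) :
    lam * (gauge C (prox C lam y) - gauge C x) ≤
      inner ℝ (y - prox C lam y) (prox C lam y - x) := by
  set w := prox C lam y with hw
  have hmin := isMinOn_prox hC hC0 hlam y
  -- Compare `w` with `(1-s)w + sx`, use convexity of the gauge, and divide by `s`; the quadratic
  -- remainder vanishes as `s → 0`.
  have key : ∀ s : ℝ, 0 < s → s < 1 → lam * (gauge C w - gauge C x) ≤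
      inner ℝ (y - w) (w - x) + s / 2 * ‖w - x‖ ^ 2 := by
    intro s hs0 hs1
    have h1 : (1 / 2) * ‖y - w‖ ^ 2 + lam * gauge C w ≤
        (1 / 2) * ‖y - ((1 - s) • w + s • x)‖ ^ 2 + lam * gauge C ((1 - s) • w + s • x) :=
      hmin (Set.mem_univ _)
    have h2 : gauge C ((1 - s) • w + s • x) ≤ (1 - s) * gauge C w + s * gauge C x := by
      refine (gauge_add_le hC (absorbent_of_zero_mem_interior hC0) _ _).trans_eq ?_
      rw [gauge_smul_of_nonneg (by linarith), gauge_smul_of_nonneg hs0.le, smul_eq_mul,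
        smul_eq_mul]
    have h3 : y - ((1 - s) • w + s • x) = (y - w) + s • (w - x) := by
      module
    rw [h3, norm_add_sq_real, norm_smul, inner_smul_right, Real.norm_of_nonneg hs0.le] at h1
    have h4 := mul_le_mul_of_nonneg_left h2 hlam
    have h5 : s * (lam * (gauge C w - gauge C x)) ≤
        s * (inner ℝ (y - w) (w - x) + s / 2 * ‖w - x‖ ^ 2) := by
      nlinarith
    exact le_of_mul_le_mul_left h5 hs0
  have hlim : Filter.Tendsto (fun s : ℝ => inner ℝ (y - w) (w - x) + s / 2 * ‖w - x‖ ^ 2)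
      (nhdsWithin 0 (Set.Ioi 0)) (nhds (inner ℝ (y - w) (w - x))) := by
    have : Continuous fun s : ℝ => inner ℝ (y - w) (w - x) + s / 2 * ‖w - x‖ ^ 2 := by fun_prop
    have h0 := this.tendsto 0
    simp only [zero_div, zero_mul, add_zero] at h0
    exact h0.mono_left nhdsWithin_le_nhds
  refine ge_of_tendsto hlim ?_
  filter_upwards [Ioo_mem_nhdsGT (zero_lt_one (α := ℝ))] with s hs
  exact key s hs.1 hs.2

/-- The denoising error is at most the distance of the noise to the scaled subdifferential. -/
lemma norm_prox_sub_le_infDist (hC : Convex ℝ C) (hC0 : (0 : E p) ∈ interior C) {lam : ℝ}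
    (hlam : 0 ≤ lam) (y x : E p) :
    ‖prox C lam y - x‖ ≤ Metric.infDist (y - x) (lam • subdifferential (gauge C) x) := by
  -- Nonemptiness matters: `Metric.infDist` to the empty set is 0, which would make the bound false.
  refine (Metric.le_infDist (subdifferential_gauge_nonempty hC hC0 x).smul_set).2 ?_
  rintro _ ⟨z, hz, rfl⟩
  simp only
  set w := prox C lam y with hw
  have h1 : lam * (gauge C w - gauge C x) ≤ inner ℝ (y - w) (w - x) :=
    mul_gauge_sub_le_inner hC hC0 hlam y x
  have h2 := mul_le_mul_of_nonneg_left (hz w) hlam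
  have h3 : inner ℝ (y - w) (w - x) = inner ℝ (y - x - lam • z) (w - x) - ‖w - x‖ ^ 2
      + lam * inner ℝ z (w - x) := by
    rw [← real_inner_self_eq_norm_sq, ← real_inner_smul_left, ← inner_sub_left, ← inner_add_left]
    congr 1
    module
  -- Optimality of `w` and the subgradient inequality for `z` bound the same gauge difference from
  -- opposite sides; it cancels, and Cauchy–Schwarz finishes.
  have h4 : ‖w - x‖ ^ 2 ≤ ‖y - x - lam • z‖ * ‖w - x‖ := by
    have := real_inner_le_norm (y - x - lam • z) (w - x)
    nlinarith
  rw [dist_eq_norm]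
  rcases eq_or_lt_of_le (norm_nonneg (w - x)) with h | h
  · rw [← h]; positivity
  · rw [pow_two] at h4
    exact le_of_mul_le_mul_right h4 h

end Denoising

/-! ### Law of the averaged noise and the deviation bound for one window. -/

section NoiseLaw

variable {p : ℕ} {Ω : Type*} [MeasurableSpace Ω] {P : Measure Ω}

/-- The normalised sum of independent `𝒩(0, σ² I)` vectors is a standard Gaussian vector. -/
lemma map_smul_sum_eq_stdGaussian [IsProbabilityMeasure P] {ε : ℕ → Ω → E p} {σ : ℝ} (hσ : 0 < σ)
    {s : Finset ℕ} (hs : s.Nonempty)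
    (hlaw : ∀ t ∈ s, HasLaw (ε t) ((stdGaussian (E p)).map (fun g => σ • g)) P)
    (hindep : iIndepFun (s.restrict ε) P) :
    P.map (fun ω => (1 / (σ * Real.sqrt s.card)) • ∑ t ∈ s, ε t ω) = stdGaussian (E p) := by
  have hm : ∀ t ∈ s, AEMeasurable (ε t) P := fun t ht => (hlaw t ht).aemeasurable
  have hms : AEMeasurable (fun ω => ∑ t ∈ s, ε t ω) P := Finset.aemeasurable_fun_sum s hm
  have : IsProbabilityMeasure (P.map fun ω => (1 / (σ * Real.sqrt s.card)) • ∑ t ∈ s, ε t ω) :=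
    Measure.isProbabilityMeasure_map (hms.fun_const_smul _)
  have hcard : (0 : ℝ) < s.card := by exact_mod_cast hs.card_pos
  refine Measure.ext_of_charFun ?_
  ext z
  rw [charFun_map_smul_comp hms, hindep.charFun_map_fun_finsetSum_eq_prod hm, Finset.prod_apply,
    charFun_stdGaussian]
  -- Each summand contributes `exp(-‖z‖²/(2·card))`; the product of `card` such factors is the
  -- standard Gaussian characteristic function.
  have h1 : ∀ t ∈ s, charFun (P.map (ε t)) ((1 / (σ * Real.sqrt s.card)) • z) =
      Complex.exp (-((‖z‖ ^ 2 / s.card : ℝ) : ℂ) / 2) := by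
    intro t ht
    rw [(hlaw t ht).map_eq, charFun_map_smul, charFun_stdGaussian, smul_smul, norm_smul,
      ← Complex.ofReal_pow, mul_pow]
    congr 4
    have hsq : Real.sqrt s.card ^ 2 = s.card := Real.sq_sqrt hcard.le
    rw [Real.norm_eq_abs, sq_abs, mul_pow, div_pow, mul_pow, hsq]
    field_simp
  rw [Finset.prod_congr rfl h1, Finset.prod_const, ← Complex.exp_nat_mul]
  congr 1
  have : (s.card : ℂ) ≠ 0 := by exact_mod_cast hcard.ne'
  push_cast
  field_simp

lemma sampleMean_add (θ : ℕ) (X : ℕ → E p) (Z : ℕ → E p) (i : ℕ) :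
    sampleMean θ (fun t => X t + Z t) i = sampleMean θ X i + sampleMean θ Z i := by
  simp [sampleMean, Finset.sum_add_distrib, smul_add]

lemma sampleMean_of_const {θ : ℕ} (hθ : 1 ≤ θ) {X : ℕ → E p} {i : ℕ} {x : E p}
    (hX : ∀ t ∈ Finset.Ico i (i + θ), X t = x) : sampleMean θ X i = x := by
  have : (θ : ℝ) ≠ 0 := by positivity
  rw [sampleMean, Finset.sum_congr rfl hX]
  simp [← Nat.cast_smul_eq_nsmul ℝ, smul_smul, this]

lemma infDist_smul_smul {c : ℝ} (hc : 0 < c) (x : E p) (S : Set (E p)) (l : ℝ) :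
    Metric.infDist (c • x) ((c * l) • S) = c * Metric.infDist x (l • S) := by
  rw [mul_smul, infDist_smul₀ hc.ne', Real.norm_of_nonneg hc.le]

lemma expectedDist_le_gaussianDistance {C : Set (E p)} {n : ℕ} {X : ℕ → E p} {l : ℝ}
    (hmin : IsMinOn (maxExpectedDist C n X) (Set.Ici 0) l) {t : ℕ} (ht : t ∈ Finset.Icc 1 n) :
    expectedDist C (X t) l ≤ gaussianDistance C n X := by
  have h1 : maxExpectedDist C n X l ≤ gaussianDistance C n X := by
    have : Nonempty (Set.Ici (0 : ℝ)) := ⟨⟨0, Set.self_mem_Ici⟩⟩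
    exact le_ciInf fun x => hmin x.2
  refine le_trans ?_ h1
  exact le_ciSup (f := fun t : Finset.Icc 1 n => expectedDist C (X t) l)
    (Set.finite_range _).bddAbove ⟨t, ht⟩

/-- On each window where the signal is constant, the denoised average is close to the signal with
high probability. -/
lemma measureReal_window_deviation_le [IsProbabilityMeasure P] {n θ : ℕ} {X : ℕ → E p}
    {ε : ℕ → Ω → E p} {σ r lam₀ : ℝ} {C : Set (E p)} (hσ : 0 < σ) (hθ : 1 ≤ θ)
    (hε_law : ∀ t ∈ Finset.Icc 1 n,
      HasLaw (ε t) ((stdGaussian (E p)).map (fun g => σ • g)) P)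
    (hε_indep : iIndepFun (fun t : Finset.Icc 1 n => ε t) P) (hn : 1 ≤ n) (hr : 0 ≤ r)
    (hmin : IsMinOn (maxExpectedDist C n X) (Set.Ici 0) lam₀)
    {i : ℕ} (hi1 : 1 ≤ i) (hin : i + θ ≤ n + 1) :
    P.real {ω | (σ / Real.sqrt θ) * (gaussianDistance C n X + r * Real.sqrt (2 * Real.log n)) ≤
      Metric.infDist (sampleMean θ (fun t => ε t ω) i)
        ((σ / Real.sqrt θ * lam₀) • subdifferential (gauge C) (X i))} ≤ (n : ℝ) ^ (-r ^ 2) := by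
  have hn0 : (0 : ℝ) < n := by positivity
  have hθ0 : (0 : ℝ) < θ := by exact_mod_cast hθ
  have hκ : 0 < σ / Real.sqrt θ := by positivity
  have hsub : Finset.Ico i (i + θ) ⊆ Finset.Icc 1 n := by
    intro t ht
    simp only [Finset.mem_Ico, Finset.mem_Icc] at ht ⊢
    omega
  have hcard : (Finset.Ico i (i + θ)).card = θ := by simp
  have hiI : i ∈ Finset.Icc 1 n := hsub (by simp; omega)
  have hind : iIndepFun ((Finset.Ico i (i + θ)).restrict ε) P :=
    iIndepFun.precomp (g := fun t : Finset.Ico i (i + θ) => (⟨t.1, hsub t.2⟩ : Finset.Icc 1 n))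
      (fun a b h => Subtype.ext (congrArg (fun x : Finset.Icc 1 n => x.1) h)) hε_indep
  have hlaw := map_smul_sum_eq_stdGaussian hσ (s := Finset.Ico i (i + θ))
    (by simp; omega) (fun t ht => hε_law t (hsub ht)) hind
  rw [hcard] at hlaw
  set W : Ω → E p := fun ω => (1 / (σ * Real.sqrt θ)) • ∑ t ∈ Finset.Ico i (i + θ), ε t ω with hW
  have hWm : AEMeasurable W P :=
    (Finset.aemeasurable_fun_sum _ fun t ht => (hε_law t (hsub ht)).aemeasurable).fun_const_smul _
  have hmean : ∀ ω, sampleMean θ (fun t => ε t ω) i = (σ / Real.sqrt θ) • W ω := by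
    intro ω
    rw [sampleMean, hW, smul_smul]
    congr 1
    have hsq : Real.sqrt θ * Real.sqrt θ = θ := Real.mul_self_sqrt hθ0.le
    have : 0 < Real.sqrt θ := by positivity
    field_simp
    linarith
  set S := lam₀ • subdifferential (gauge C) (X i) with hS
  set s := r * Real.sqrt (2 * Real.log n) with hs
  have hs0 : 0 ≤ s := by positivity
  have hset : {ω | (σ / Real.sqrt θ) * (gaussianDistance C n X + s) ≤
      Metric.infDist (sampleMean θ (fun t => ε t ω) i)
        ((σ / Real.sqrt θ * lam₀) • subdifferential (gauge C) (X i))} =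
      W ⁻¹' {g | gaussianDistance C n X + s ≤ Metric.infDist g S} := by
    ext ω
    simp only [Set.mem_ofPred_eq, Set.mem_preimage]
    -- Both the noise and `lam` carry the factor `σ/√θ`, so it cancels from the event.
    rw [hmean, infDist_smul_smul hκ]
    exact mul_le_mul_iff_right₀ hκ
  have hmeas : MeasurableSet {g : E p | gaussianDistance C n X + s ≤ Metric.infDist g S} :=
    measurableSet_le measurable_const (Metric.continuous_infDist_pt S).measurable
  rw [hset, ← map_measureReal_apply_of_aemeasurable hWm hmeas, hlaw]
  have hle : expectedDist C (X i) lam₀ ≤ gaussianDistance C n X :=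
    expectedDist_le_gaussianDistance hmin hiI
  have hconc := stdGaussian_concentration (Metric.lipschitz_infDist_pt S)
    (fun x => Metric.infDist_nonneg) hs0
  refine (measureReal_mono ?_).trans (hconc.trans (le_of_eq ?_))
  · intro g hg
    exact (add_le_add_left hle s).trans hg
  · have hlog : 0 ≤ Real.log n := Real.log_nonneg (by exact_mod_cast hn)
    rw [Real.rpow_def_of_pos hn0, hs, mul_pow, Real.sq_sqrt (by positivity)]
    congr 1
    ring

end NoiseLaw

/-! ### Splitting a sorted list into separated clusters. -/

section Grouping

/-- If all members of an increasing list are at distance less than `θ` from one of its members,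
then consecutive members are at most `θ` apart. -/
lemma isChain_of_forall_near {θ : ℕ} {l : List ℕ} (hl : l.Pairwise (· < ·)) {s : ℕ} (hs : s ∈ l)
    (hnear : ∀ t ∈ l, s < t + θ ∧ t < s + θ) :
    l.IsChain fun a b => decide (b - a ≤ θ) = true := by
  rw [List.isChain_iff_getElem]
  intro i hi
  obtain ⟨k, hk, rfl⟩ := List.getElem_of_mem hs
  have h1 := hnear _ (List.getElem_mem (l := l) (n := i) (by omega))
  have h2 := hnear _ (List.getElem_mem hi)
  have hmono := hl.sortedLT.strictMono_get
  -- `s` is itself in the list, so no consecutive pair straddles it: both members lie on one side of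
  -- `s`, within `θ` of it.
  rcases Nat.lt_or_ge k (i + 1) with h | h
  · have : l[k] ≤ l[i] := hmono.monotone (a := ⟨k, hk⟩) (b := ⟨i, by omega⟩)
      (by simp only [Fin.mk_le_mk]; omega)
    simp only [decide_eq_true_eq]
    omega
  · have : l[i + 1] ≤ l[k] := hmono.monotone (a := ⟨i + 1, hi⟩) (b := ⟨k, hk⟩) h
    simp only [decide_eq_true_eq]
    omega

/-- If the times `A` cluster at distance less than `θ` around well separated members `τ` of `A`,
then cutting `A` at gaps larger than `θ` recovers the clusters. -/
lemma splitBy_sort_eq_map_cluster {θ : ℕ} (hθ : 1 ≤ θ) {A τ : Finset ℕ} (hτA : τ ⊆ A)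
    (hA : ∀ t ∈ A, ∃ s ∈ τ, s < t + θ ∧ t < s + θ)
    (hsep : ∀ s ∈ τ, ∀ s' ∈ τ, s < s' → s + 3 * θ ≤ s') :
    (A.sort (· ≤ ·)).splitBy (fun s t => decide (t - s ≤ θ)) =
      (τ.sort (· ≤ ·)).map fun s =>
        (A.filter fun t => s < t + θ ∧ t < s + θ).sort (· ≤ ·) := by
  set B : ℕ → List ℕ := fun s => (A.filter fun t => s < t + θ ∧ t < s + θ).sort (· ≤ ·) with hB
  have memB : ∀ s t, t ∈ B s ↔ t ∈ A ∧ s < t + θ ∧ t < s + θ := by simp [hB]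
  have selfB : ∀ s ∈ τ, s ∈ B s := fun s hs => (memB s s).2 ⟨hτA hs, by omega, by omega⟩
  have hBlt : ∀ s, (B s).Pairwise (· < ·) := fun s => (Finset.sortedLT_sort _).pairwise
  have hτlt : (τ.sort (· ≤ ·)).Pairwise fun s s' => s + 3 * θ ≤ s' :=
    (Finset.sortedLT_sort τ).pairwise.imp_of_mem fun {a b} ha hb hab =>
      hsep a ((Finset.mem_sort _).1 ha) b ((Finset.mem_sort _).1 hb) hab
  refine List.splitBy_eq_iff.2 ⟨?_, ?_, ?_, ?_⟩
  · have hlt : (List.map B (τ.sort (· ≤ ·))).flatten.Pairwise (· < ·) := by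
      rw [List.pairwise_flatten]
      refine ⟨?_, ?_⟩
      · intro l hl
        obtain ⟨s, -, rfl⟩ := List.mem_map.1 hl
        exact hBlt s
      · rw [List.pairwise_map]
        refine hτlt.imp fun {s s'} hss t ht t' ht' => ?_
        have := (memB _ _).1 ht
        have := (memB _ _).1 ht'
        omega
    have hset : (List.map B (τ.sort (· ≤ ·))).flatten.toFinset = A := by
      ext t
      simp only [List.mem_toFinset, List.mem_flatten, List.mem_map, Finset.mem_sort]
      constructor
      · rintro ⟨_, ⟨s, -, rfl⟩, ht⟩
        exact ((memB s t).1 ht).1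
      · intro ht
        obtain ⟨s, hs, h⟩ := hA t ht
        exact ⟨_, ⟨s, hs, rfl⟩, (memB s t).2 ⟨ht, h⟩⟩
    rw [← hset]
    exact (List.toFinset_sort (· ≤ ·) (hlt.imp fun h => h.ne)).2 (hlt.imp fun h => h.le)
  · intro h
    obtain ⟨s, hs, h⟩ := List.mem_map.1 h
    have := selfB s ((Finset.mem_sort _).1 hs)
    rw [h] at this
    simp at this
  · intro l hl
    obtain ⟨s, hs, rfl⟩ := List.mem_map.1 hl
    exact isChain_of_forall_near (hBlt s) (selfB s ((Finset.mem_sort _).1 hs))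
      fun t ht => ((memB s t).1 ht).2
  · refine List.Pairwise.isChain ?_
    rw [List.pairwise_map]
    refine hτlt.imp_of_mem fun {s s'} hs hs' hss => ?_
    have h1 := List.ne_nil_of_mem (selfB s ((Finset.mem_sort _).1 hs))
    have h2 := List.ne_nil_of_mem (selfB s' ((Finset.mem_sort _).1 hs'))
    refine ⟨h1, h2, ?_⟩
    -- The last member is below `s + θ` and the next head above `s' - θ`. Spacing `3θ` thus leaves a
    -- gap exceeding `θ`.
    have := (memB _ _).1 (List.getLast_mem h1)
    have := (memB _ _).1 (List.head_mem h2)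
    simp only [decide_eq_false_iff_not]
    omega

end Grouping

/-! ### Deterministic detection of change-points. -/

section Detection

variable {p : ℕ}

lemma eq_of_no_changePoint {n : ℕ} {X : ℕ → E p} {a b : ℕ} (ha : 1 ≤ a) (hb : b ≤ n)
    (h : ∀ t, a ≤ t → t < b → t ∉ changePoints n X) : ∀ t, a ≤ t → t ≤ b → X t = X a := by
  intro t hat
  induction t, hat using Nat.le_induction with
  | base => exact fun _ => rfl
  | succ t hat ih =>
    intro htb
    rw [← ih (by omega)]
    have := h t hat (by omega)
    simp only [changePoints, Finset.mem_filter, Finset.mem_Ico, not_and, not_not] at this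
    exact (this ⟨by omega, by omega⟩).symm

/-- Deterministic part: if every denoised average over a window of constancy is close to the signal,
then the groups are clusters around the change-points. -/
lemma groups_spec {C : Set (E p)} {n θ : ℕ} {X Y : ℕ → E p} {Δ T γ lam κ : ℝ}
    (hθ : 1 ≤ θ) (hΔ : IsMinChange n X Δ) (hT : IsMinSpacing n X T)
    (hτ : ∀ t ∈ changePoints n X, T / 4 ≤ (t : ℝ) ∧ (t : ℝ) ≤ n - T / 4)
    (hθT : (θ : ℝ) ≤ T / 4) (hγΔ : γ ≤ Δ / 2) (hκγ : 2 * κ ≤ γ)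
    (hclose : ∀ i, 1 ≤ i → i + θ ≤ n + 1 → (∀ t ∈ Finset.Ico i (i + θ), X t = X i) →
      ‖denoised C θ lam Y i - X i‖ < κ) :
    (groups C n θ γ lam Y).length = (changePoints n X).card ∧
      ∀ (j : ℕ) (hj : j < (groups C n θ γ lam Y).length)
        (hj' : j < ((changePoints n X).sort (· ≤ ·)).length), ∀ s ∈ (groups C n θ γ lam Y)[j],
        s ∈ Finset.Icc θ (n - θ) ∧
          |((((changePoints n X).sort (· ≤ ·))[j] : ℕ) : ℝ) - (s : ℝ)| ≤ θ := by
  set τ := changePoints n X with hτdef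
  have hτθ : ∀ t ∈ τ, θ ≤ t ∧ t + θ ≤ n := by
    intro t ht
    obtain ⟨h1, h2⟩ := hτ t ht
    refine ⟨by exact_mod_cast hθT.trans h1, ?_⟩
    have : (t : ℝ) + θ ≤ n := by linarith
    exact_mod_cast this
  have hsep : ∀ s ∈ τ, ∀ s' ∈ τ, s < s' → s + 4 * θ ≤ s' := by
    intro s hs s' hs' hss
    have hle := (hT ⟨s, hs, s', hs', hss.ne⟩).2 ⟨s', hs', s, hs, hss.ne', rfl⟩
    have hpos : (s : ℝ) < s' := by exact_mod_cast hss
    rw [abs_of_pos (by linarith)] at hle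
    have : (s : ℝ) + 4 * θ ≤ s' := by linarith
    exact_mod_cast this
  have hmem : ∀ t, t ∈ activeTimes C n θ γ lam Y ↔
      (θ ≤ t ∧ t ≤ n - θ) ∧ γ ≤ derivativeNorm C θ lam Y t ∧ derivativeNorm C θ lam Y t ≠ 0 := by
    intro t
    rw [activeTimes, Finset.mem_filter, Finset.mem_Icc, thresholded]
    split_ifs with h
    · simp [h]
    · simp [not_lt.1 h]
  -- `S[t]` compares the windows `[t-θ+1, t]` and `[t+1, t+θ]`. A change-point at `t` itself breaks
  -- neither, since the jump occurs between `t` and `t+1`.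
  have hleft : ∀ t, θ ≤ t → t ≤ n → (∀ s, t + 1 - θ ≤ s → s < t → s ∉ τ) →
      ‖denoised C θ lam Y (t - θ + 1) - X t‖ < κ := by
    intro t h1 h2 h3
    have hc := eq_of_no_changePoint (n := n) (X := X) (a := t - θ + 1) (b := t) (by omega)
      h2 (fun s hs hs' => h3 s (by omega) hs')
    rw [hc t (by omega) le_rfl]
    refine hclose _ (by omega) (by omega) fun s hs => ?_
    rw [Finset.mem_Ico] at hs
    exact hc s hs.1 (by omega)
  have hright : ∀ t, t + θ ≤ n → (∀ s, t + 1 ≤ s → s < t + θ → s ∉ τ) →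
      ‖denoised C θ lam Y (t + 1) - X (t + 1)‖ < κ := by
    intro t h2 h3
    have hc := eq_of_no_changePoint (n := n) (X := X) (a := t + 1) (b := t + θ) (by omega) h2 h3
    refine hclose _ (by omega) (by omega) fun s hs => ?_
    rw [Finset.mem_Ico] at hs
    exact hc s hs.1 (by omega)
  have hτA : τ ⊆ activeTimes C n θ γ lam Y := by
    intro t ht
    obtain ⟨h1, h2⟩ := hτθ t ht
    have hl := hleft t h1 (by omega) fun s hs hs' hsτ => by
      have := hsep s hsτ t ht hs'; omega
    have hr := hright t h2 fun s hs hs' hsτ => by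
      have := hsep t ht s hsτ hs; omega
    have hjump : Δ ≤ ‖X t - X (t + 1)‖ := (hΔ ⟨t, ht⟩).2 ⟨t, ht, rfl⟩
    have htri : ‖X t - X (t + 1)‖ ≤ ‖denoised C θ lam Y (t - θ + 1) - X t‖ +
        derivativeNorm C θ lam Y t + ‖denoised C θ lam Y (t + 1) - X (t + 1)‖ := by
      simp only [derivativeNorm, ← dist_eq_norm]
      rw [dist_comm _ (X t), dist_comm (denoised C θ lam Y (t + 1)) (denoised C θ lam Y _)]
      exact dist_triangle4 _ _ _ _
    -- The strict bound on a norm forces `κ > 0`, hence `γ > 0`: reaching the threshold then also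
    -- makes `S[t]` nonzero.
    have hκ : 0 < κ := lt_of_le_of_lt (norm_nonneg _) hl
    exact (hmem t).2 ⟨⟨h1, by omega⟩, by linarith, by linarith [hjump]⟩
  have hA : ∀ t ∈ activeTimes C n θ γ lam Y, ∃ s ∈ τ, s < t + θ ∧ t < s + θ := by
    intro t ht
    obtain ⟨⟨h1, h2⟩, h3, -⟩ := (hmem t).1 ht
    -- With no change-point at distance less than `θ`, the signal is constant across both windows,
    -- so `S[t] < 2κ ≤ γ`.
    by_contra! hno
    have hl := hleft t h1 (by omega) fun s hs hs' hsτ => by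
      have := hno s hsτ (by omega); omega
    have hr := hright t (by omega) fun s hs hs' hsτ => by
      have := hno s hsτ (by omega); omega
    have heq : X (t + 1) = X t := by
      have : t ∉ τ := fun htτ => by have := hno t htτ (by omega); omega
      exact eq_of_no_changePoint (n := n) (X := X) (a := t) (b := t + 1) (by omega) (by omega)
        (fun s hs hs' => by rwa [show s = t by omega]) (t + 1) (by omega) le_rfl
    rw [heq] at hr
    have htri : derivativeNorm C θ lam Y t ≤ ‖denoised C θ lam Y (t + 1) - X t‖ +
        ‖denoised C θ lam Y (t - θ + 1) - X t‖ := by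
      rw [derivativeNorm]
      simpa using norm_sub_le (denoised C θ lam Y (t + 1) - X t)
        (denoised C θ lam Y (t - θ + 1) - X t)
    linarith
  have hG : groups C n θ γ lam Y = (τ.sort (· ≤ ·)).map fun s =>
      ((activeTimes C n θ γ lam Y).filter fun t => s < t + θ ∧ t < s + θ).sort (· ≤ ·) :=
    splitBy_sort_eq_map_cluster hθ hτA hA fun s hs s' hs' hss => by
      have := hsep s hs s' hs' hss; omega
  refine ⟨by simp [hG], ?_⟩
  intro j hj hj' s hs
  simp only [hG, List.getElem_map, Finset.mem_sort, Finset.mem_filter] at hs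
  obtain ⟨hsA, hs1, hs2⟩ := hs
  refine ⟨Finset.mem_Icc.2 ((hmem s).1 hsA).1, ?_⟩
  rw [abs_le]
  have h1 : ((((τ.sort (· ≤ ·))[j] : ℕ)) : ℝ) < s + θ := by exact_mod_cast hs1
  have h2 : (s : ℝ) < ((((τ.sort (· ≤ ·))[j] : ℕ)) : ℝ) + θ := by exact_mod_cast hs2
  constructor <;> linarith

end Detection

end ChangePoint

/-! ### The union bound and the conclusion. -/

theorem corollary1 {p n : ℕ} (hn : 1 ≤ n)
    {Ω : Type*} [MeasurableSpace Ω] (P : Measure Ω) [IsProbabilityMeasure P]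
    -- the signal, and independent `𝒩(0, σ² I)` noise at times `1, …, n`
    (X : ℕ → ChangePoint.E p) (ε : ℕ → Ω → ChangePoint.E p) (σ : ℝ) (hσ : 0 < σ)
    (hε_law : ∀ t ∈ Finset.Icc 1 n,
      HasLaw (ε t) ((stdGaussian (ChangePoint.E p)).map (fun g => σ • g)) P)
    (hε_indep : iIndepFun (fun t : Finset.Icc 1 n => ε t) P)
    -- the convex set defining the gauge
    (C : Set (ChangePoint.E p)) (hC : Convex ℝ C) (hC0 : (0 : ChangePoint.E p) ∈ interior C)
    -- the smallest change, the smallest spacing, and the conditions on them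
    (Δ T r : ℝ) (hΔ : ChangePoint.IsMinChange n X Δ) (hT : ChangePoint.IsMinSpacing n X T)
    (hr : 1 < r)
    (hsuff : 64 * σ ^ 2 *
      (ChangePoint.gaussianDistance C n X + r * Real.sqrt (2 * Real.log n)) ^ 2 ≤ Δ ^ 2 * T)
    (hτ : ∀ t ∈ ChangePoint.changePoints n X, T / 4 ≤ (t : ℝ) ∧ (t : ℝ) ≤ n - T / 4)
    -- the parameters of the algorithm
    (θ : ℕ) (hθ : 1 ≤ θ) (hθT : (θ : ℝ) ≤ T / 4)
    (γ : ℝ) (hγΔ : γ ≤ Δ / 2)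
    (hγ : 2 * (σ / Real.sqrt θ) *
      (ChangePoint.gaussianDistance C n X + r * Real.sqrt (2 * Real.log n)) ≤ γ)
    (lam lam₀ : ℝ) (hlam₀ : 0 ≤ lam₀)
    (hargmin : IsMinOn (ChangePoint.maxExpectedDist C n X) (Set.Ici 0) lam₀)
    (hlam : lam = σ / Real.sqrt θ * lam₀) :
    1 - 4 * (n : ℝ) ^ (1 - r ^ 2) <
      P.real {ω |
        let G := ChangePoint.groups C n θ γ lam (fun t => X t + ε t ω)
        let τ := (ChangePoint.changePoints n X).sort (· ≤ ·)
        G.length = (ChangePoint.changePoints n X).card ∧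
        ∀ (j : ℕ) (hj : j < G.length) (hj' : j < τ.length), ∀ s ∈ G[j],
          s ∈ Finset.Icc θ (n - θ) ∧ |(τ[j] : ℝ) - (s : ℝ)| ≤ θ} := by
  have hn0 : (0 : ℝ) < n := by exact_mod_cast hn
  set κ := σ / Real.sqrt θ *
    (ChangePoint.gaussianDistance C n X + r * Real.sqrt (2 * Real.log n)) with hκ
  -- All windows that fit in `1, …, n`, constant or not: `bad i` involves only the noise and `X i`,
  -- so constancy is needed only when the event is used.
  set I := (Finset.Icc 1 n).filter fun i => i + θ ≤ n + 1 with hI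
  set bad : ℕ → Set Ω := fun i => {ω | κ ≤ Metric.infDist
    (ChangePoint.sampleMean θ (fun t => ε t ω) i)
      (lam • ChangePoint.subdifferential (gauge C) (X i))} with hbad
  have hlam0 : 0 ≤ lam := by rw [hlam]; positivity
  have hbadP : P.real (⋃ i ∈ I, bad i) ≤ (n : ℝ) ^ (1 - r ^ 2) := by
    have hone : ∀ i ∈ I, P.real (bad i) ≤ (n : ℝ) ^ (-r ^ 2) := by
      intro i hi
      rw [hI, Finset.mem_filter, Finset.mem_Icc] at hi
      have := ChangePoint.measureReal_window_deviation_le (C := C) (X := X) (r := r)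
        (lam₀ := lam₀) hσ hθ hε_law hε_indep
        hn (by linarith) hargmin hi.1.1 hi.2
      rwa [← hlam] at this
    have hcard : (I.card : ℝ) ≤ n := by
      exact_mod_cast (Finset.card_filter_le _ _).trans (by simp)
    calc P.real (⋃ i ∈ I, bad i) ≤ ∑ i ∈ I, P.real (bad i) :=
          measureReal_biUnion_finset_le I bad
      _ ≤ ∑ i ∈ I, (n : ℝ) ^ (-r ^ 2) := Finset.sum_le_sum hone
      _ = I.card * (n : ℝ) ^ (-r ^ 2) := by simp
      _ ≤ n * (n : ℝ) ^ (-r ^ 2) := by gcongr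
      _ = (n : ℝ) ^ (1 - r ^ 2) := by
        rw [sub_eq_add_neg, Real.rpow_add hn0, Real.rpow_one]
  have hpos : 0 < (n : ℝ) ^ (1 - r ^ 2) := Real.rpow_pos_of_pos hn0 _
  have hcover : 1 ≤ P.real (⋃ i ∈ I, bad i)ᶜ + P.real (⋃ i ∈ I, bad i) := by
    have := measureReal_union_le (μ := P) (⋃ i ∈ I, bad i)ᶜ (⋃ i ∈ I, bad i)
    rwa [Set.compl_union_self, probReal_univ] at this
  -- The union bound gives `1 - n^(1-r²)`; the factor 4 and positivity of the power make the
  -- inequality strict.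
  refine lt_of_lt_of_le (by linarith : _ < P.real (⋃ i ∈ I, bad i)ᶜ) (measureReal_mono ?_)
  intro ω hω
  simp only [Set.mem_compl_iff, Set.mem_iUnion, not_exists] at hω
  refine ChangePoint.groups_spec (κ := κ) hθ hΔ hT hτ hθT hγΔ (by rw [hκ]; linarith) ?_
  intro i hi1 hin hconst
  have hiI : i ∈ I := by
    rw [hI, Finset.mem_filter, Finset.mem_Icc]
    omega
  have hgood : _ < κ := not_le.1 (hω i hiI)
  refine lt_of_le_of_lt ?_ hgood
  have h := ChangePoint.norm_prox_sub_le_infDist hC hC0 hlam0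
    (ChangePoint.sampleMean θ (fun t => X t + ε t ω) i) (X i)
  have hnoise : ChangePoint.sampleMean θ (fun t => X t + ε t ω) i - X i =
      ChangePoint.sampleMean θ (fun t => ε t ω) i := by
    rw [ChangePoint.sampleMean_add θ X (fun t => ε t ω) i,
      ChangePoint.sampleMean_of_const hθ hconst, add_sub_cancel_left]
  rwa [hnoise] at h
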